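/- Let $\mathcal S=(\mathcal S_n)_{n\ge 1}$ be an expansion of the ordered field of real numbers, i.e. $\mathcal S_n$ is a collection of subsets of $\mathbb R^n$ (the definable sets) such that: (1) $\mathcal S_n$ contains $\emptyset$ and is closed under finite unions and complements; (2) $A\in\mathcal S_n$, $B\in\mathcal S_m$ imply $A\times B\in\mathcal S_{n+m}$; (3) if $A\in\mathcal S_{n+1}$, its projection to the first $n$ coordinates belongs to $\mathcal S_n$; (4) every semialgebraic subset of $\mathbb R^n$ belongs to $\mathcal S_n$. (Every o-minimal structure on the real field is of this kind; o-minimality is not needed.) A map $\mathbb R^n\to\mathbb R^m$ is definable if its graph is a definable subset of $\mathbb R^{n+m}$. For $A\subseteq\mathbb R^n$ and $x\in\mathbb R^n$, let $T_xA$ be the set of $C^1$-Zariski tangent vectors to $A$ at $x$, i.e. of all $v\in\mathbb R^n$ such that $df_x(v)=0$ for every $C^1$ function $f:\mathbb R^n\to\mathbb R$ vanishing identically on $A$. Given vector fields $X_1,\dots,X_r:\mathbb R^n\to\mathbb R^n$, let $\mathrm{char}(A)=\{p\in A:\ X_j(p)\in T_pA \text{ for every } j=1,\dots,r\}$. Then,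 for every $n\ge 1$: (a) if $A\subseteq\mathbb R^n$ is closed and definable, the $C^1$-Zariski tangent bundle $TA=\{(x,v)\in\mathbb R^{n}\times\mathbb R^n:\ x\in A,\ v\in T_xA\}$ is a definable subset of $\mathbb R^{2n}$; (b) if $X_1,\dots,X_r:\mathbb R^n\to\mathbb R^n$ are definable vector fields (not necessarily continuous) and $A\subseteq\mathbb R^n$ is definable (not necessarily closed), then $\mathrm{char}(A)$ is definable. -/

import Mathlib

/-- The subset `A × B` of `ℝ^(n+m)`, for `A ⊆ ℝ^n` and `B ⊆ ℝ^m`. -/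
def euclideanProd {n m : ℕ} (A : Set (Fin n → ℝ)) (B : Set (Fin m → ℝ)) :
    Set (Fin (n + m) → ℝ) :=
  {z | (fun i => z (Fin.castAdd m i)) ∈ A ∧ (fun i => z (Fin.natAdd n i)) ∈ B}

/-- Semialgebraic subsets of `ℝ^n`: finite unions of sets, each of which is cut out by finitely many
polynomial equations `p = 0` and finitely many polynomial inequalities `q > 0`, with real
coefficients. -/
def IsSemialgebraic {n : ℕ} (A : Set (Fin n → ℝ)) : Prop :=
  ∃ C : Finset (Finset (MvPolynomial (Fin n) ℝ) × Finset (MvPolynomial (Fin n) ℝ)),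
    A = {x | ∃ c ∈ C, (∀ p ∈ c.1, MvPolynomial.eval x p = 0) ∧
      ∀ q ∈ c.2, 0 < MvPolynomial.eval x q}

/-- An expansion of the ordered field of real numbers, given through its definable sets: for every
`n ≥ 1` a collection `sets n` of subsets of `ℝ^n` (the value at `n = 0` carries no meaning). -/
structure RealFieldExpansion where
  sets : (n : ℕ) → Set (Set (Fin n → ℝ))
  empty_mem : ∀ n, 1 ≤ n → ∅ ∈ sets n
  union_mem : ∀ n, 1 ≤ n → ∀ A ∈ sets n, ∀ B ∈ sets n, A ∪ B ∈ sets n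
  compl_mem : ∀ n, 1 ≤ n → ∀ A ∈ sets n, Aᶜ ∈ sets n
  prod_mem : ∀ n m, 1 ≤ n → 1 ≤ m → ∀ A ∈ sets n, ∀ B ∈ sets m, euclideanProd A B ∈ sets (n + m)
  proj_mem : ∀ n, 1 ≤ n → ∀ A ∈ sets (n + 1),
    (fun (z : Fin (n + 1) → ℝ) (i : Fin n) => z i.castSucc) '' A ∈ sets n
  semialgebraic_mem : ∀ n, 1 ≤ n → ∀ A : Set (Fin n → ℝ), IsSemialgebraic A → A ∈ sets n

namespace RealFieldExpansion

/-- A subset of `ℝ^n` is definable in the given structure. -/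
def IsDefinable (S : RealFieldExpansion) {n : ℕ} (A : Set (Fin n → ℝ)) : Prop :=
  A ∈ S.sets n

/-- A map `ℝ^n → ℝ^m` is definable if its graph is a definable subset of `ℝ^(n+m)`. -/
def IsDefinableMap (S : RealFieldExpansion) {n m : ℕ} (f : (Fin n → ℝ) → (Fin m → ℝ)) : Prop :=
  S.IsDefinable {z : Fin (n + m) → ℝ |
    (fun i => z (Fin.natAdd n i)) = f (fun i => z (Fin.castAdd m i))}

end RealFieldExpansion

/-- The set `T_x A` of vectors that are `C^1`-Zariski tangent to `A` at `x`. -/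
def zariskiTangent {n : ℕ} (A : Set (Fin n → ℝ)) (x : Fin n → ℝ) : Set (Fin n → ℝ) :=
  {v | ∀ f : (Fin n → ℝ) → ℝ, ContDiff ℝ 1 f → (∀ y ∈ A, f y = 0) → fderiv ℝ f x v = 0}

/-- The `C^1`-Zariski tangent bundle `TA = {(x, v) : x ∈ A, v ∈ T_x A}`, as a subset of
`ℝ^(2n)`. -/
def zariskiTangentBundle {n : ℕ} (A : Set (Fin n → ℝ)) : Set (Fin (n + n) → ℝ) :=
  {z | (fun i => z (Fin.castAdd n i)) ∈ A ∧
    (fun i => z (Fin.natAdd n i)) ∈ zariskiTangent A (fun i => z (Fin.castAdd n i))}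

/-- The set `char(A)` of points of `A` at which every one of the vector fields `X j` is
`C^1`-Zariski tangent to `A`. -/
def charSet {n r : ℕ} (X : Fin r → (Fin n → ℝ) → (Fin n → ℝ)) (A : Set (Fin n → ℝ)) :
    Set (Fin n → ℝ) :=
  {p | p ∈ A ∧ ∀ j, X j p ∈ zariskiTangent A p}

/-! The space `T_x A` is the annihilator of the conormal space of all differentials at `x` of `C^1`
functions vanishing on `A`, so it suffices to describe that conormal space by a first-order formula
over `A`. Replacing `A` by its closure changes no tangent space (`zariskiTangent_closure`), so `A`
may be taken closed.

Two conditions are necessary for `p` to be such a differential at `z`. Strict differentiability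
forces `p` to kill secants of `A` in the limit at `z` (`secantAnnihilator`). Continuity of the
differential forces `p` to be a limit of admissible covectors at every sequence of points tending to
`z`, and this can be iterated (`glaeserRefinement`). Both conditions are first-order, and the
iteration stabilises after `2 (n + 1)` steps, a bound independent of `A` and of the point
(`glaeserRefinement_iterate_fixed`). The result is therefore a single formula.

The conditions are also sufficient. A bundle fixed by refinement is lower semicontinuous, so Michael
selection puts a continuous section through each of its vectors (`exists_continuous_section`). That
section annihilates secants, so a `C^1` Whitney extension with zero values
(`exists_contDiff_of_secant`) realises it as a differential. -/

namespace RealFieldExpansion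

/-! ### Calculus of definable predicates -/

variable (S : RealFieldExpansion)

theorem inter_mem {n : ℕ} (hn : 1 ≤ n) {A B : Set (Fin n → ℝ)} (hA : A ∈ S.sets n)
    (hB : B ∈ S.sets n) : A ∩ B ∈ S.sets n := by
  have h := S.compl_mem n hn _ (S.union_mem n hn _ (S.compl_mem n hn _ hA) _
    (S.compl_mem n hn _ hB))
  rwa [Set.compl_union, compl_compl, compl_compl] at h

theorem eval_pos_mem {n : ℕ} (hn : 1 ≤ n) (p : MvPolynomial (Fin n) ℝ) :
    {x | 0 < MvPolynomial.eval x p} ∈ S.sets n :=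
  S.semialgebraic_mem n hn _ ⟨{(∅, {p})}, by simp⟩

theorem univ_mem {n : ℕ} (hn : 1 ≤ n) : Set.univ ∈ S.sets n := by
  simpa using S.compl_mem n hn _ (S.empty_mem n hn)

theorem forall_eval_eq_zero_mem {n k : ℕ} (hn : 1 ≤ n) (p : Fin k → MvPolynomial (Fin n) ℝ) :
    {x | ∀ i, MvPolynomial.eval x (p i) = 0} ∈ S.sets n := by
  classical
  exact S.semialgebraic_mem n hn _ ⟨{(Finset.univ.image p, ∅)}, by simp⟩

theorem proj_mem_add {n : ℕ} (hn : 1 ≤ n) (k : ℕ) (A : Set (Fin (n + k) → ℝ))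
    (hA : A ∈ S.sets (n + k)) :
    (fun (z : Fin (n + k) → ℝ) (i : Fin n) => z (Fin.castAdd k i)) '' A ∈ S.sets n := by
  induction k with
  | zero =>
    change id '' A ∈ S.sets n
    rw [Set.image_id]
    exact hA
  | succ k ih =>
    have h := ih _ (S.proj_mem (n + k) (by omega) A hA)
    rw [Set.image_image] at h
    exact h

/-- A predicate on a real vector space is definable if its pullbacks along all linear maps from
coordinate spaces of positive dimension are definable sets. -/
def DefPred {X : Type*} [AddCommGroup X] [Module ℝ X] (P : X → Prop) : Prop :=
  ∀ m, 1 ≤ m → ∀ L : (Fin m → ℝ) →ₗ[ℝ] X, {x | P (L x)} ∈ S.sets m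

/-- A real function on a real vector space is polynomial if its pullbacks along all linear maps from
coordinate spaces are given by polynomials. -/
def _root_.IsPolyFun {X : Type*} [AddCommGroup X] [Module ℝ X] (f : X → ℝ) : Prop :=
  ∀ (m : ℕ) (L : (Fin m → ℝ) →ₗ[ℝ] X), ∃ p : MvPolynomial (Fin m) ℝ,
    ∀ x, f (L x) = MvPolynomial.eval x p

end RealFieldExpansion

section IsPolyFun

variable {X : Type*} [AddCommGroup X] [Module ℝ X] {f g : X → ℝ}

theorem IsPolyFun.of_isLinearMap (hf : IsLinearMap ℝ f) : IsPolyFun f := by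
  intro m L
  refine ⟨∑ i, MvPolynomial.C (f (L (Pi.single i 1))) * MvPolynomial.X i, fun x => ?_⟩
  have h := LinearMap.pi_apply_eq_sum_univ ((IsLinearMap.mk' f hf).comp L) x
  simp only [LinearMap.comp_apply, IsLinearMap.mk'_apply, smul_eq_mul] at h
  rw [h, map_sum]
  refine Finset.sum_congr rfl fun i _ => ?_
  rw [map_mul, MvPolynomial.eval_C, MvPolynomial.eval_X, mul_comm]
  congr 3
  ext j
  simp [Pi.single_apply, eq_comm]

theorem IsPolyFun.const (c : ℝ) : IsPolyFun (fun _ : X => c) :=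
  fun _ _ => ⟨MvPolynomial.C c, by simp⟩

theorem IsPolyFun.mul (hf : IsPolyFun f) (hg : IsPolyFun g) : IsPolyFun (fun x => f x * g x) := by
  intro m L
  obtain ⟨p, hp⟩ := hf m L
  obtain ⟨q, hq⟩ := hg m L
  exact ⟨p * q, fun x => by simp only [hp, hq, map_mul]⟩

theorem IsPolyFun.sub (hf : IsPolyFun f) (hg : IsPolyFun g) : IsPolyFun (fun x => f x - g x) := by
  intro m L
  obtain ⟨p, hp⟩ := hf m L
  obtain ⟨q, hq⟩ := hg m L
  exact ⟨p - q, fun x => by simp only [hp, hq, map_sub]⟩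

theorem IsPolyFun.sum {ι : Type*} (s : Finset ι) {f : ι → X → ℝ} (hf : ∀ i, IsPolyFun (f i)) :
    IsPolyFun (fun x => ∑ i ∈ s, f i x) := by
  intro m L
  choose p hp using fun i => hf i m L
  exact ⟨∑ i ∈ s, p i, fun x => by simp [hp]⟩

end IsPolyFun

namespace RealFieldExpansion

variable {S : RealFieldExpansion} {X Y : Type*} [AddCommGroup X] [Module ℝ X] [AddCommGroup Y]
  [Module ℝ Y]

namespace DefPred

theorem comp {P : X → Prop} (hP : S.DefPred P) (f : Y → X) (hf : IsLinearMap ℝ f) :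
    S.DefPred (fun y => P (f y)) :=
  fun m hm L => hP m hm ((IsLinearMap.mk' f hf).comp L)

theorem not {P : X → Prop} (hP : S.DefPred P) : S.DefPred (fun x => ¬ P x) :=
  fun m hm L => S.compl_mem m hm _ (hP m hm L)

theorem and {P Q : X → Prop} (hP : S.DefPred P) (hQ : S.DefPred Q) :
    S.DefPred (fun x => P x ∧ Q x) :=
  fun m hm L => S.inter_mem hm (hP m hm L) (hQ m hm L)

theorem imp {P Q : X → Prop} (hP : S.DefPred P) (hQ : S.DefPred Q) :
    S.DefPred (fun x => P x → Q x) := by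
  have h := (hP.and hQ.not).not
  simpa only [not_and, not_not] using h

theorem const (p : Prop) : S.DefPred (fun _ : X => p) := by
  intro m hm L
  by_cases h : p
  · simpa [h] using S.univ_mem hm
  · simpa [h] using S.empty_mem m hm

theorem forall_fin {ι : Type*} [Finite ι] {P : ι → X → Prop} (hP : ∀ i, S.DefPred (P i)) :
    S.DefPred (fun x => ∀ i, P i x) := by
  classical
  cases nonempty_fintype ι
  have h : ∀ s : Finset ι, S.DefPred (fun x => ∀ i ∈ s, P i x) := by
    intro s
    induction s using Finset.induction_on with
    | empty => simpa using const True
    | insert a s _ ih => simpa only [Finset.forall_mem_insert] using (hP a).and ih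
  simpa using h Finset.univ

theorem lt {f g : X → ℝ} (hf : IsPolyFun f) (hg : IsPolyFun g) :
    S.DefPred (fun x => f x < g x) := by
  intro m hm L
  obtain ⟨p, hp⟩ := (hg.sub hf) m L
  have h := S.eval_pos_mem hm p
  simpa only [← hp, sub_pos] using h

theorem le {f g : X → ℝ} (hf : IsPolyFun f) (hg : IsPolyFun g) :
    S.DefPred (fun x => f x ≤ g x) := by
  simpa only [not_lt] using (lt (S := S) hg hf).not

theorem eq {f g : X → ℝ} (hf : IsPolyFun f) (hg : IsPolyFun g) :
    S.DefPred (fun x => f x = g x) := by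
  simpa only [← le_antisymm_iff] using (le (S := S) hf hg).and (le hg hf)

/-- A basis of `Y` turns the quantifier into a projection of a coordinate space. Allowing arbitrary
linear pullbacks in `DefPred` lets variables range over nested products without reindexing. -/
theorem ex [FiniteDimensional ℝ Y] {P : X → Y → Prop}
    (hP : S.DefPred (fun z : X × Y => P z.1 z.2)) : S.DefPred (fun x => ∃ y, P x y) := by
  intro m hm L
  set k := Module.finrank ℝ Y
  let e : Y ≃ₗ[ℝ] (Fin k → ℝ) := (Module.finBasis ℝ Y).equivFun
  let p₁ : (Fin (m + k) → ℝ) →ₗ[ℝ] (Fin m → ℝ) := LinearMap.funLeft ℝ ℝ (Fin.castAdd k)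
  let p₂ : (Fin (m + k) → ℝ) →ₗ[ℝ] (Fin k → ℝ) := LinearMap.funLeft ℝ ℝ (Fin.natAdd m)
  have h := S.proj_mem_add hm k _
    (hP (m + k) (by omega) ((L.comp p₁).prod (e.symm.toLinearMap.comp p₂)))
  convert h using 1
  ext x
  constructor
  · rintro ⟨y, hy⟩
    have h₁ : p₁ (Fin.append x (e y)) = x := by
      ext i; simp [p₁, LinearMap.funLeft_apply]
    have h₂ : p₂ (Fin.append x (e y)) = e y := by
      ext i; simp [p₂, LinearMap.funLeft_apply]
    refine ⟨Fin.append x (e y), ?_, h₁⟩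
    simpa [h₁, h₂] using hy
  · rintro ⟨z, hz, rfl⟩
    exact ⟨_, hz⟩

theorem all [FiniteDimensional ℝ Y] {P : X → Y → Prop}
    (hP : S.DefPred (fun z : X × Y => P z.1 z.2)) : S.DefPred (fun x => ∀ y, P x y) := by
  simpa only [not_exists, not_not] using (ex (P := fun x y => ¬ P x y) hP.not).not

/-- The axioms give no linear preimages directly; the preimage of `A` under `L` is obtained as the
projection of the part of `ℝ^m × A` lying on the graph of `L`, which is cut out by polynomial
equations. -/
theorem of_mem {n : ℕ} (hn : 1 ≤ n) {A : Set (Fin n → ℝ)} (hA : S.IsDefinable A) :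
    S.DefPred (fun x => x ∈ A) := by
  intro m hm L
  have hpoly : ∀ i, IsPolyFun (fun z : Fin (m + n) → ℝ =>
      z (Fin.natAdd m i) - L (fun j => z (Fin.castAdd n j)) i) := fun i =>
    (IsPolyFun.of_isLinearMap ⟨fun _ _ => rfl, fun _ _ => rfl⟩).sub
      (IsPolyFun.of_isLinearMap (f := fun z : Fin (m + n) → ℝ => L (fun j => z (Fin.castAdd n j)) i)
        ((LinearMap.proj i).comp (L.comp (LinearMap.funLeft ℝ ℝ (Fin.castAdd n)))).isLinear)
  choose p hp using fun i => hpoly i (m + n) LinearMap.id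
  have h := S.proj_mem_add hm n _ (S.inter_mem (by omega)
    (S.prod_mem m n hm hn _ (S.univ_mem hm) _ hA)
    (S.forall_eval_eq_zero_mem (by omega) p))
  simp only [← hp, sub_eq_zero, LinearMap.id_apply] at h
  convert h using 1
  ext x
  constructor
  · intro hx
    refine ⟨Fin.append x (L x), ⟨⟨trivial, ?_⟩, ?_⟩, ?_⟩
    · simpa using hx
    · intro i; simp
    · ext i; simp
  · rintro ⟨z, ⟨⟨-, hz⟩, hz'⟩, rfl⟩
    have hz'' : (fun i => z (Fin.natAdd m i)) = L (fun j => z (Fin.castAdd n j)) := funext hz'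
    change L (fun j => z (Fin.castAdd n j)) ∈ A
    rwa [← hz'']

theorem mem {n : ℕ} (hn : 1 ≤ n) {P : (Fin n → ℝ) → Prop} (hP : S.DefPred P) :
    S.IsDefinable {x | P x} := hP n hn LinearMap.id

/-- Closeness in the sup norm of two coordinate vectors is a definable relation. -/
theorem norm_sub_lt {n : ℕ} {f g : X → Fin n → ℝ} {r : X → ℝ} (hf : IsLinearMap ℝ f)
    (hg : IsLinearMap ℝ g) (hr : IsPolyFun r) : S.DefPred (fun x => ‖f x - g x‖ < r x) := by
  have hfi : ∀ i, IsPolyFun (fun x => f x i) := fun i =>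
    IsPolyFun.of_isLinearMap ((LinearMap.proj i).comp (IsLinearMap.mk' f hf)).isLinear
  have hgi : ∀ i, IsPolyFun (fun x => g x i) := fun i =>
    IsPolyFun.of_isLinearMap ((LinearMap.proj i).comp (IsLinearMap.mk' g hg)).isLinear
  have h := (lt (S := S) (IsPolyFun.const 0) hr).and (forall_fin fun i =>
    (lt (S := S) ((hfi i).sub (hgi i)) hr).and (lt (S := S) ((hgi i).sub (hfi i)) hr))
  convert h using 3 with x
  constructor
  · intro hx
    have hpos := (norm_nonneg _).trans_lt hx
    refine ⟨hpos, fun i => ?_⟩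
    have := abs_lt.1 ((pi_norm_lt_iff hpos).1 hx i)
    simp only [Pi.sub_apply] at this
    constructor <;> linarith
  · rintro ⟨hpos, hx⟩
    refine (pi_norm_lt_iff hpos).2 fun i => abs_lt.2 ?_
    have := hx i
    simp only [Pi.sub_apply]
    constructor <;> linarith

end DefPred

end RealFieldExpansion

open Filter Topology Metric

/-! ### Michael selection -/

section Selection

variable {X E : Type*} [TopologicalSpace X] [NormalSpace X] [ParacompactSpace X]
  [NormedAddCommGroup E] [NormedSpace ℝ E] {t : X → Set E}

/-- The improvement step for Michael's theorem: lower semicontinuity makes a constant an approximate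
selection near each point, and convexity lets a partition of unity glue these constants while
staying close to the previous approximation. -/
theorem exists_continuous_mem_thickening (hconv : ∀ x, Convex ℝ (t x))
    (hlsc : ∀ x, ∀ p ∈ t x, ∀ ε > 0, ∀ᶠ y in 𝓝 x, p ∈ thickening ε (t y)) {h : X → E}
    (hh : Continuous h) {δ ε : ℝ} (hε : 0 < ε) (hδ : ∀ x, h x ∈ thickening δ (t x)) :
    ∃ g : C(X, E), ∀ x, g x ∈ thickening ε (t x) ∩ ball (h x) δ := by
  refine exists_continuous_forall_mem_convex_of_local_const
    (fun x => ((hconv x).thickening ε).inter (convex_ball _ _)) fun x => ?_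
  obtain ⟨q, hq, hxq⟩ := mem_thickening_iff.1 (hδ x)
  refine ⟨q, (hlsc x q hq ε hε).and ?_⟩
  have hd : Continuous fun y => dist q (h y) := by fun_prop
  exact hd.tendsto x |>.eventually_lt_const (by rwa [dist_comm])

/-- Michael's selection theorem for lower semicontinuous families of nonempty closed convex sets. -/
theorem exists_continuous_selection [CompleteSpace E] (hne : ∀ x, (t x).Nonempty)
    (hclosed : ∀ x, IsClosed (t x)) (hconv : ∀ x, Convex ℝ (t x))
    (hlsc : ∀ x, ∀ p ∈ t x, ∀ ε > 0, ∀ᶠ y in 𝓝 x, p ∈ thickening ε (t y)) :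
    ∃ g : C(X, E), ∀ x, g x ∈ t x := by
  -- The approximation hypothesis sits inside the existential so that the choice of `g` is a total
  -- function of `k` and `h`, which can be iterated.
  have hstep : ∀ (k : ℕ) (h : C(X, E)), ∃ g : C(X, E),
      (∀ x, h x ∈ thickening ((1 / 2) ^ k) (t x)) →
      ∀ x, g x ∈ thickening ((1 / 2) ^ (k + 1)) (t x) ∩ ball (h x) ((1 / 2) ^ k) := by
    intro k h
    by_cases hh : ∀ x, h x ∈ thickening ((1 / 2) ^ k) (t x)
    · obtain ⟨g, hg⟩ := exists_continuous_mem_thickening hconv hlsc h.continuous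
        (ε := (1 / 2) ^ (k + 1)) (by positivity) hh
      exact ⟨g, fun _ => hg⟩
    · exact ⟨h, fun h' => absurd h' hh⟩
  choose F hF using hstep
  obtain ⟨g₀, hg₀⟩ : ∃ g : C(X, E), ∀ x, g x ∈ thickening 1 (t x) := by
    refine exists_continuous_forall_mem_convex_of_local_const
      (fun x => (hconv x).thickening 1) fun x => ?_
    obtain ⟨q, hq⟩ := hne x
    exact ⟨q, hlsc x q hq 1 one_pos⟩
  let g : ℕ → C(X, E) := fun k => Nat.rec g₀ F k
  have hg : ∀ k, ∀ x, g k x ∈ thickening ((1 / 2) ^ k) (t x) := by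
    intro k
    induction k with
    | zero =>
      intro x
      rw [pow_zero]
      exact hg₀ x
    | succ k ih => exact fun x => (hF k (g k) ih x).1
  have hdist : ∀ x k, dist (g k x) (g (k + 1) x) ≤ 1 * (1 / 2 : ℝ) ^ k := by
    intro x k
    have := (hF k (g k) (hg k) x).2
    rw [one_mul, dist_comm]
    exact (mem_ball.1 this).le
  have hlim : ∀ x, ∃ a, Tendsto (fun k => g k x) atTop (𝓝 a) := fun x =>
    cauchySeq_tendsto_of_complete (cauchySeq_of_le_geometric _ _ (by norm_num) (hdist x))
  choose G hG using hlim
  have hbound : ∀ k x, dist (g k x) (G x) ≤ 2 * (1 / 2 : ℝ) ^ k := by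
    intro k x
    refine (dist_le_of_le_geometric_of_tendsto _ _ (by norm_num) (hdist x) (hG x) k).trans_eq ?_
    ring
  have hzero : Tendsto (fun k : ℕ => (1 / 2 : ℝ) ^ k) atTop (𝓝 0) :=
    tendsto_pow_atTop_nhds_zero_of_lt_one (by norm_num) (by norm_num)
  have hunif : TendstoUniformly (fun k x => g k x) G atTop := by
    rw [Metric.tendstoUniformly_iff]
    intro ε hε
    filter_upwards [hzero.eventually_lt_const (half_pos hε)] with k hk x
    rw [dist_comm]
    have := hbound k x
    linarith
  refine ⟨⟨G, hunif.continuous (Frequently.of_forall fun k => (g k).continuous)⟩, fun x => ?_⟩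
  refine (hclosed x).closure_subset (Metric.mem_closure_iff.2 fun ε hε => ?_)
  obtain ⟨k, hk⟩ := (hzero.eventually_lt_const (show 0 < ε / 3 by positivity)).exists
  obtain ⟨q, hq, hgq⟩ := mem_thickening_iff.1 (hg k x)
  refine ⟨q, hq, ?_⟩
  have h₁ := hbound k x
  have h₂ := dist_triangle_left (G x) q (g k x)
  simp only [ContinuousMap.coe_mk]
  linarith

/-- A lower semicontinuous family of closed linear subspaces has a continuous section through every
vector. -/
theorem exists_continuous_section [CompleteSpace E] [T1Space X] {B : X → Submodule ℝ E}
    (hclosed : ∀ x, IsClosed (B x : Set E))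
    (hlsc : ∀ x, ∀ p ∈ B x, ∀ ε > 0, ∀ᶠ y in 𝓝 x, ∃ q ∈ B y, ‖p - q‖ < ε) {x₀ : X} {p₀ : E}
    (hp₀ : p₀ ∈ B x₀) : ∃ g : C(X, E), (∀ x, g x ∈ B x) ∧ g x₀ = p₀ := by
  classical
  -- Shrinking one fibre to a point prescribes the value there. Lower semicontinuity survives: at
  -- `x₀` by that of `B` at `p₀`, elsewhere because `x₀` is a closed point.
  let t : X → Set E := fun x => if x = x₀ then {p₀} else B x
  have ht₀ : t x₀ = {p₀} := if_pos rfl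
  have ht : ∀ x, x ≠ x₀ → t x = B x := fun x hx => if_neg hx
  have hsub : ∀ x, t x ⊆ B x := by
    intro x
    rcases eq_or_ne x x₀ with rfl | hx
    · simpa [ht₀] using hp₀
    · rw [ht x hx]
  suffices h : ∃ g : C(X, E), ∀ x, g x ∈ t x by
    obtain ⟨g, hg⟩ := h
    exact ⟨g, fun x => hsub x (hg x), by simpa [ht₀] using hg x₀⟩
  apply exists_continuous_selection
  · intro x
    rcases eq_or_ne x x₀ with rfl | hx
    · simp [ht₀]
    · rw [ht x hx]
      exact ⟨0, (B x).zero_mem⟩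
  · intro x
    rcases eq_or_ne x x₀ with rfl | hx
    · simp [ht₀]
    · rw [ht x hx]
      exact hclosed x
  · intro x
    rcases eq_or_ne x x₀ with rfl | hx
    · simp [ht₀]
    · rw [ht x hx]
      exact (B x).convex
  · intro x p hp ε hε
    have hev : ∀ᶠ y in 𝓝 x, y = x ∨ y ≠ x₀ := by
      rcases eq_or_ne x x₀ with rfl | hx
      · exact Eventually.of_forall fun y => em _
      · filter_upwards [isOpen_ne.mem_nhds hx] with y hy using Or.inr hy
    filter_upwards [hev, hlsc x p (hsub x hp) ε hε] with y hy hq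
    rcases hy with rfl | hy
    · exact self_subset_thickening hε _ hp
    · obtain ⟨q, hq, hpq⟩ := hq
      exact mem_thickening_iff.2 ⟨q, by rwa [ht y hy], by rwa [dist_eq_norm]⟩

end Selection

/-! ### Glaeser refinement and its stabilisation -/

section Refinement

variable {X W : Type*} [TopologicalSpace X] [NormedAddCommGroup W] [NormedSpace ℝ W]

/-- The Glaeser refinement of a family of linear subspaces: only those vectors are kept which are
limits of vectors from the neighbouring subspaces. -/
def glaeserRefinement (B : X → Submodule ℝ W) (x : X) : Submodule ℝ W where
  carrier := {p | p ∈ B x ∧ ∀ ε > 0, ∀ᶠ y in 𝓝 x, ∃ q ∈ B y, ‖p - q‖ < ε}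
  zero_mem' := ⟨zero_mem _, fun ε hε => Eventually.of_forall fun y => ⟨0, zero_mem _, by simpa⟩⟩
  add_mem' := by
    rintro p p' ⟨hp, hp'⟩ ⟨hr, hr'⟩
    refine ⟨add_mem hp hr, fun ε hε => ?_⟩
    filter_upwards [hp' _ (half_pos hε), hr' _ (half_pos hε)] with y ⟨q, hq, h⟩ ⟨q', hq', h'⟩
    refine ⟨q + q', add_mem hq hq', ?_⟩
    rw [add_sub_add_comm]
    linarith [norm_add_le (p - q) (p' - q')]
  smul_mem' := by
    rintro c p ⟨hp, hp'⟩
    refine ⟨Submodule.smul_mem _ c hp, fun ε hε => ?_⟩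
    have hc : 0 < ‖c‖ + 1 := by positivity
    filter_upwards [hp' (ε / (‖c‖ + 1)) (by positivity)] with y ⟨q, hq, h⟩
    refine ⟨c • q, Submodule.smul_mem _ c hq, ?_⟩
    rw [← smul_sub, norm_smul]
    rw [lt_div_iff₀ hc] at h
    nlinarith [norm_nonneg (p - q)]

theorem mem_glaeserRefinement {B : X → Submodule ℝ W} {x : X} {p : W} :
    p ∈ glaeserRefinement B x ↔ p ∈ B x ∧ ∀ ε > 0, ∀ᶠ y in 𝓝 x, ∃ q ∈ B y, ‖p - q‖ < ε :=
  Iff.rfl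

theorem glaeserRefinement_le (B : X → Submodule ℝ W) (x : X) : glaeserRefinement B x ≤ B x :=
  fun _ hp => hp.1

theorem glaeserRefinement_eventuallyEq {B C : X → Submodule ℝ W} {x : X} (h : B =ᶠ[𝓝 x] C) :
    glaeserRefinement B =ᶠ[𝓝 x] glaeserRefinement C := by
  filter_upwards [h.eventually_nhds] with y hy
  ext p
  rw [mem_glaeserRefinement, mem_glaeserRefinement, hy.self_of_nhds]
  refine and_congr_right fun _ => forall₂_congr fun ε _ => eventually_congr ?_
  filter_upwards [hy] with z hz
  rw [hz]

/-- Linear independence is an open condition, and a basis of the refined fibre at `x` is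
approximated by vectors of every nearby fibre. -/
theorem eventually_finrank_glaeserRefinement_le [FiniteDimensional ℝ W] (B : X → Submodule ℝ W)
    (x : X) :
    ∀ᶠ y in 𝓝 x, Module.finrank ℝ (glaeserRefinement B x) ≤ Module.finrank ℝ (B y) := by
  let b := Module.finBasis ℝ (glaeserRefinement B x)
  have hb : LinearIndependent ℝ fun i => (b i : W) :=
    b.linearIndependent.map' _ (Submodule.ker_subtype _)
  obtain ⟨ε, hε, hball⟩ := Metric.eventually_nhds_iff.1 hb.eventually
  filter_upwards [eventually_all.2 fun i => (b i).2.2 ε hε] with y hy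
  choose q hq hbq using hy
  have hli : LinearIndependent ℝ q := hball <| by
    rw [dist_pi_lt_iff hε]
    intro i
    rw [dist_comm, dist_eq_norm]
    exact hbq i
  have hli' : LinearIndependent ℝ fun i => (⟨q i, hq i⟩ : B y) :=
    LinearIndependent.of_comp (B y).subtype hli
  simpa using hli'.fintype_card_le_finrank

theorem iterate_glaeserRefinement_eventuallyEq {B : X → Submodule ℝ W} {x : X} {k : ℕ}
    (h : glaeserRefinement^[k + 1] B =ᶠ[𝓝 x] glaeserRefinement^[k] B) (j : ℕ) :
    glaeserRefinement^[k + j] B =ᶠ[𝓝 x] glaeserRefinement^[k] B := by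
  induction j with
  | zero => rfl
  | succ j ih =>
    rw [← add_assoc, Function.iterate_succ_apply']
    refine (glaeserRefinement_eventuallyEq ih).trans ?_
    rwa [← Function.iterate_succ_apply' glaeserRefinement]

/-- Induction on codimension; for `k = 0` the hypothesis is impossible. In the step, a fibre of
dimension at least `dim W - k` after `2k + 2` refinements forces nearby fibres to have at least this
dimension after `2k + 1`. A nearby fibre that was larger after `2k` refinements is already stable by
induction; any other had no room to shrink at the next one. So the bundle stops changing on a
neighbourhood, and refinement is local. -/
theorem iterate_glaeserRefinement_stable_of_le_finrank [FiniteDimensional ℝ W]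
    (B : X → Submodule ℝ W) (k : ℕ) : ∀ x,
    Module.finrank ℝ W + 1 ≤ k + Module.finrank ℝ (glaeserRefinement^[2 * k] B x) →
    ∀ j, glaeserRefinement^[2 * k + j] B x = glaeserRefinement^[2 * k] B x := by
  induction k with
  | zero =>
    intro x hx
    have := (glaeserRefinement^[2 * 0] B x).finrank_le
    omega
  | succ k ih =>
    intro x hx
    have hev : glaeserRefinement^[2 * k + 1] B =ᶠ[𝓝 x] glaeserRefinement^[2 * k] B := by
      filter_upwards [eventually_finrank_glaeserRefinement_le (glaeserRefinement^[2 * k + 1] B) x]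
        with y hy
      rw [← Function.iterate_succ_apply' glaeserRefinement] at hy
      by_cases hdim : Module.finrank ℝ W + 1 ≤
          k + Module.finrank ℝ (glaeserRefinement^[2 * k] B y)
      · exact ih y hdim 1
      · refine Submodule.eq_of_le_of_finrank_le ?_ ?_
        · rw [Function.iterate_succ_apply']
          exact glaeserRefinement_le _ _
        · have : 2 * (k + 1) = (2 * k + 1).succ := by omega
          rw [this] at hx
          omega
    intro j
    have h := iterate_glaeserRefinement_eventuallyEq hev
    have h₁ := (h (2 + j)).self_of_nhds
    have h₂ := (h 2).self_of_nhds
    rw [show 2 * (k + 1) + j = 2 * k + (2 + j) by ring, h₁,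
      show 2 * (k + 1) = 2 * k + 2 by ring, h₂]

/-- After `2 (dim W + 1)` steps the iterated Glaeser refinement does not change any more. -/
theorem glaeserRefinement_iterate_fixed [FiniteDimensional ℝ W] (B : X → Submodule ℝ W) :
    glaeserRefinement (glaeserRefinement^[2 * (Module.finrank ℝ W + 1)] B) =
      glaeserRefinement^[2 * (Module.finrank ℝ W + 1)] B := by
  funext x
  rw [← Function.iterate_succ_apply' glaeserRefinement]
  exact iterate_glaeserRefinement_stable_of_le_finrank B _ x (Nat.le_add_right _ _) 1

end Refinement

/-! ### Penalty functions -/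

section Penalty

open MeasureTheory intervalIntegral

/-- A monotone modulus which vanishes at the origin is dominated by one which is the difference
quotient of a function with small local Lipschitz constants near the origin. -/
theorem exists_penalty {ω : ℝ → ℝ} (hmono : Monotone ω) (hnonneg : ∀ t, 0 ≤ ω t) {K : ℝ}
    (hK : ∀ t, ω t ≤ K) (hpos : ∀ t, 0 < t → 0 < ω t) (hlim : ∀ ε > 0, ∃ δ > 0, ω δ ≤ ε) :
    ∃ θ : ℝ → ℝ, θ 0 = 0 ∧ Monotone θ ∧ (∀ t, 0 < t → 0 < θ t) ∧ (∀ t ≥ 0, t * ω t ≤ θ t) ∧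
      (∀ s t, |θ s - θ t| ≤ 2 * K * |s - t|) ∧
      ∀ ε > 0, ∃ δ > 0, ∀ s t, s ≤ δ → t ≤ δ → |θ s - θ t| ≤ ε * |s - t| := by
  have hint : ∀ a b, IntervalIntegrable ω volume a b := fun a b => hmono.intervalIntegrable
  have hsub : ∀ s t, (∫ u in (0 : ℝ)..2 * s, ω u) - ∫ u in (0 : ℝ)..2 * t, ω u =
      ∫ u in (2 * t)..2 * s, ω u := fun s t => integral_interval_sub_left (hint _ _) (hint _ _)
  have hlip : ∀ M δ s t, ω (2 * δ) ≤ M → s ≤ δ → t ≤ δ →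
      |(∫ u in (0 : ℝ)..2 * s, ω u) - ∫ u in (0 : ℝ)..2 * t, ω u| ≤ 2 * M * |s - t| := by
    intro M δ s t hM hs ht
    rw [hsub]
    have h := norm_integral_le_of_norm_le_const (a := 2 * t) (b := 2 * s) (f := ω) (C := M) ?_
    · rw [Real.norm_eq_abs, ← mul_sub, abs_mul, abs_two] at h
      linarith
    · intro u hu
      rw [Real.norm_of_nonneg (hnonneg u)]
      refine (hmono ?_).trans hM
      have := (Set.mem_uIoc.1 hu)
      rcases this with h | h <;> linarith [h.2]
  have hge : ∀ s t, s ≤ t → 2 * (t - s) * ω (2 * s) ≤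
      (∫ u in (0 : ℝ)..2 * t, ω u) - ∫ u in (0 : ℝ)..2 * s, ω u := by
    intro s t hst
    rw [hsub]
    have h := integral_mono_on (a := 2 * s) (b := 2 * t) (f := fun _ => ω (2 * s)) (g := ω)
      (by linarith) intervalIntegrable_const (hint _ _) fun u hu => hmono hu.1
    rw [intervalIntegral.integral_const, smul_eq_mul] at h
    linarith
  have hmono' : Monotone fun t => ∫ u in (0 : ℝ)..2 * t, ω u := by
    intro s t hst
    have h := hge s t hst
    have h' : 0 ≤ 2 * (t - s) * ω (2 * s) := mul_nonneg (by linarith) (hnonneg _)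
    simp only
    linarith
  have hlow : ∀ t ≥ 0, t * ω t ≤ ∫ u in (0 : ℝ)..2 * t, ω u := by
    intro t ht
    have h := hge (t / 2) t (by linarith)
    have h' : 0 ≤ ∫ u in (0 : ℝ)..2 * (t / 2), ω u :=
      integral_nonneg (by linarith) fun u _ => hnonneg u
    rw [show 2 * (t / 2) = t by ring] at h h'
    have : 2 * (t - t / 2) = t := by ring
    rw [this] at h
    linarith
  -- Integrating up to `2 * t` gives the lower bound, since the half from `t` to `2 * t` alone
  -- contributes at least `t * ω t`; the Lipschitz constant below `δ` is at most `2 * ω (2 * δ)`.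
  refine ⟨fun t => ∫ u in (0 : ℝ)..2 * t, ω u, by simp, hmono', ?_, hlow, ?_, ?_⟩
  · intro t ht
    exact (mul_pos ht (hpos t ht)).trans_le (hlow t ht.le)
  · intro s t
    exact hlip K (max s t) s t (hK _) (le_max_left _ _) (le_max_right _ _)
  · intro ε hε
    obtain ⟨δ, hδ, h⟩ := hlim (ε / 2) (half_pos hε)
    refine ⟨δ / 2, half_pos hδ, fun s t hs ht => ?_⟩
    have := hlip (ε / 2) (δ / 2) s t (by rwa [mul_div_cancel₀ _ two_ne_zero]) hs ht
    linarith

/-- Uniformly small ratios at small distances are dominated by a penalty function. -/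
theorem exists_penalty_of_ratio {ι : Type*} {d r : ι → ℝ} {K : ℝ} (hd : ∀ i, 0 ≤ d i)
    (hK : ∀ i, r i ≤ K) (hlim : ∀ ε > 0, ∃ δ > 0, ∀ i, d i ≤ δ → r i ≤ ε) :
    ∃ (θ : ℝ → ℝ) (C : ℝ), 0 ≤ C ∧ θ 0 = 0 ∧ Monotone θ ∧ (∀ t, 0 < t → 0 < θ t) ∧
      (∀ i, d i * r i ≤ θ (d i)) ∧ (∀ s t, |θ s - θ t| ≤ C * |s - t|) ∧
      ∀ ε > 0, ∃ δ > 0, ∀ s t, s ≤ δ → t ≤ δ → |θ s - θ t| ≤ ε * |s - t| := by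
  classical
  let m : ℝ → Set ℝ := fun t => insert 0 (r '' {i | d i ≤ t})
  have hne : ∀ t, (m t).Nonempty := fun t => ⟨0, Set.mem_insert _ _⟩
  have hbdd : ∀ t, BddAbove (m t) := fun t =>
    bddAbove_insert.2 ⟨K, by rintro _ ⟨i, -, rfl⟩; exact hK i⟩
  have h0 : ∀ t, 0 ≤ sSup (m t) := fun t => le_csSup (hbdd t) (Set.mem_insert _ _)
  -- The truncated linear term keeps `ω` bounded and small near the origin but makes it positive for
  -- `t > 0`, even when all ratios vanish.
  let ω : ℝ → ℝ := fun t => sSup (m t) + max 0 (min t 1)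
  have hmono : Monotone ω := by
    intro s t hst
    refine add_le_add (csSup_le_csSup (hbdd t) (hne s) (Set.insert_subset_insert
      (Set.image_mono fun i hi => le_trans hi hst))) ?_
    exact max_le_max le_rfl (min_le_min hst le_rfl)
  have hω : ∀ t, ω t ≤ max 0 K + 1 := by
    intro t
    refine add_le_add (csSup_le (hne t) ?_) (max_le zero_le_one (min_le_right _ _))
    rintro _ (rfl | ⟨i, -, rfl⟩)
    · exact le_max_left _ _
    · exact (hK i).trans (le_max_right _ _)
  have hr0 : ∀ t, r '' {i | d i ≤ t} ⊆ m t := fun t => Set.subset_insert _ _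
  obtain ⟨θ, hθ0, hθm, hθpos, hθ, hθlip, hθlim⟩ := exists_penalty hmono
    (fun t => add_nonneg (h0 t) (le_max_left _ _)) hω
    (fun t ht => add_pos_of_nonneg_of_pos (h0 t) (lt_max_of_lt_right (lt_min ht one_pos))) (by
      intro ε hε
      obtain ⟨δ, hδ, h⟩ := hlim (ε / 2) (half_pos hε)
      refine ⟨min δ (ε / 2), lt_min hδ (half_pos hε), ?_⟩
      have h₁ : sSup (m (min δ (ε / 2))) ≤ ε / 2 := by
        refine csSup_le (hne _) ?_
        rintro _ (rfl | ⟨i, hi, rfl⟩)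
        · exact (half_pos hε).le
        · exact h i (le_trans hi (min_le_left _ _))
      have h₂ : max 0 (min (min δ (ε / 2)) 1) ≤ ε / 2 :=
        max_le (half_pos hε).le ((min_le_left _ _).trans (min_le_right _ _))
      calc ω (min δ (ε / 2)) ≤ ε / 2 + ε / 2 := add_le_add h₁ h₂
        _ = ε := add_halves ε)
  refine ⟨θ, 2 * (max 0 K + 1), by positivity, hθ0, hθm, hθpos, fun i => ?_, hθlip, hθlim⟩
  refine le_trans ?_ (hθ (d i) (hd i))
  refine mul_le_mul_of_nonneg_left ?_ (hd i)
  refine le_add_of_le_of_nonneg (le_csSup (hbdd _) (hr0 _ ⟨i, le_refl (d i), rfl⟩)) (le_max_left _ _)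

end Penalty

/-! ### Extension by a lower envelope -/

section Whitney

variable {V : Type*} [NormedAddCommGroup V] [NormedSpace ℝ V]

/-- On a compact set, a continuous field of covectors which annihilates the secants at every point
in the limit does so uniformly. -/
theorem exists_uniform_secant_bound {A : Set V} (hA : IsCompact A) {G : V → V →L[ℝ] ℝ}
    (hG : Continuous G)
    (hsec : ∀ z ∈ A, ∀ ε > 0, ∀ᶠ q : V × V in 𝓝 (z, z), q.1 ∈ A → q.2 ∈ A →
      |G z (q.1 - q.2)| ≤ ε * ‖q.1 - q.2‖) {ε : ℝ} (hε : 0 < ε) :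
    ∃ δ > 0, ∀ x ∈ A, ∀ a ∈ A, ‖x - a‖ ≤ δ → |G a (x - a)| ≤ ε * ‖x - a‖ := by
  have hloc : ∀ z : A, ∃ r > 0, ∀ x ∈ A, ∀ a ∈ A, x ∈ ball (z : V) r → a ∈ ball (z : V) r →
      |G a (x - a)| ≤ ε * ‖x - a‖ := by
    intro z
    have h₁ := hsec z z.2 (ε / 2) (half_pos hε)
    have h₂ : ∀ᶠ a in 𝓝 (z : V), ‖G a - G z‖ < ε / 2 := by
      simpa [dist_eq_norm] using Metric.continuous_iff'.1 hG z (ε / 2) (half_pos hε)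
    obtain ⟨r₁, hr₁, h₁⟩ := Metric.eventually_nhds_iff.1 h₁
    obtain ⟨r₂, hr₂, h₂⟩ := Metric.eventually_nhds_iff.1 h₂
    refine ⟨min r₁ r₂, lt_min hr₁ hr₂, fun x hx a ha hxz haz => ?_⟩
    have e₁ := h₁ (y := (x, a)) (max_lt (lt_of_lt_of_le hxz (min_le_left _ _))
      (lt_of_lt_of_le haz (min_le_left _ _))) hx ha
    have e₂ := h₂ (lt_of_lt_of_le haz (min_le_right _ _))
    have e₃ : G a (x - a) = G z (x - a) + (G a - G z) (x - a) := by simp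
    have e₄ : |(G a - G z) (x - a)| ≤ ‖G a - G z‖ * ‖x - a‖ := (G a - G z).le_opNorm _
    rw [e₃]
    refine (abs_add_le _ _).trans ?_
    simp only at e₁
    nlinarith [norm_nonneg (x - a)]
  choose r hr hloc using hloc
  obtain ⟨δ, hδ, h⟩ := lebesgue_number_lemma_of_metric hA (c := fun z : A => ball (z : V) (r z))
    (fun _ => isOpen_ball) fun z hz => Set.mem_iUnion.2 ⟨⟨z, hz⟩, mem_ball_self (hr _)⟩
  refine ⟨δ / 2, half_pos hδ, fun x hx a ha hxa => ?_⟩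
  obtain ⟨z, hz⟩ := h a ha
  refine hloc z x hx a ha (hz ?_) (hz (mem_ball_self hδ))
  rw [mem_ball, dist_eq_norm]
  linarith

/-- The extension is the lower envelope over `a ∈ A` of the affine functions `G a (x - a)`, each
penalised by `2 * θ ‖x - a‖`, where `θ` dominates the secant errors `|G a (x - a)|` on `A`. One copy
of `θ` makes the envelope vanish on `A`; the second forces minimisers for points near `z` to lie
near `z`, where `G a` is close to `G z` and `θ` has small Lipschitz constant. -/
theorem exists_lipschitz_extension {A : Set V} (hA : IsCompact A) (hne : A.Nonempty)
    {G : V → V →L[ℝ] ℝ} (hG : Continuous G)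
    (hsec : ∀ z ∈ A, ∀ ε > 0, ∀ᶠ q : V × V in 𝓝 (z, z), q.1 ∈ A → q.2 ∈ A →
      |G z (q.1 - q.2)| ≤ ε * ‖q.1 - q.2‖) :
    ∃ f : V → ℝ, Continuous f ∧ (∀ x ∈ A, f x = 0) ∧ ∀ z ∈ A, HasStrictFDerivAt f (G z) z := by
  obtain ⟨M, hM⟩ := hA.exists_bound_of_continuousOn hG.continuousOn
  have hM0 : 0 ≤ M := by
    obtain ⟨a, ha⟩ := hne
    exact (norm_nonneg _).trans (hM a ha)
  have hGle : ∀ a ∈ A, ∀ v, |G a v| ≤ M * ‖v‖ := fun a ha v =>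
    ((G a).le_opNorm v).trans (mul_le_mul_of_nonneg_right (hM a ha) (norm_nonneg _))
  obtain ⟨θ, C, hC, hθ0, hθm, hθpos, hθ, hθlip, hθlim⟩ := exists_penalty_of_ratio
    (ι := A × A) (d := fun q => ‖(q.1 : V) - q.2‖)
    (r := fun q => |G q.2 ((q.1 : V) - q.2)| / ‖(q.1 : V) - q.2‖) (K := M)
    (fun q => norm_nonneg _)
    (fun q => div_le_of_le_mul₀ (norm_nonneg _) hM0 (hGle _ q.2.2 _)) (by
      intro ε hε
      obtain ⟨δ, hδ, h⟩ := exists_uniform_secant_bound hA hG hsec hε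
      exact ⟨δ, hδ, fun q hq => div_le_of_le_mul₀ (norm_nonneg _) hε.le
        (h _ q.1.2 _ q.2.2 hq)⟩)
  have hθA : ∀ x ∈ A, ∀ a ∈ A, |G a (x - a)| ≤ θ ‖x - a‖ := by
    intro x hx a ha
    have h := hθ (⟨x, hx⟩, ⟨a, ha⟩)
    rcases eq_or_ne (‖x - a‖) 0 with h0 | h0
    · rw [h0, hθ0, norm_eq_zero.1 h0, map_zero, abs_zero]
    · simpa only [mul_div_cancel₀ _ h0] using h
  have hθnn : ∀ x a : V, 0 ≤ θ ‖x - a‖ := fun x a => hθ0 ▸ hθm (norm_nonneg _)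
  let F : V → V → ℝ := fun a x => G a (x - a) + 2 * θ ‖x - a‖
  have hθc : Continuous θ := by
    refine (LipschitzWith.of_dist_le_mul (K := ⟨C, hC⟩) fun s t => ?_).continuous
    exact hθlip s t
  have hmin : ∀ x, ∃ a ∈ A, ∀ b ∈ A, F a x ≤ F b x := by
    intro x
    have hc : Continuous fun a => F a x := by
      have : Continuous fun a => G a (x - a) := hG.clm_apply (by fun_prop)
      fun_prop
    obtain ⟨a, ha, h⟩ := hA.exists_isMinOn hne hc.continuousOn
    exact ⟨a, ha, fun b hb => h hb⟩
  choose a ha hmin using hmin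
  have hnorm : ∀ x y b : V, |‖x - b‖ - ‖y - b‖| ≤ ‖x - y‖ := by
    intro x y b
    simpa using abs_norm_sub_norm_le (x - b) (y - b)
  have hFlip : ∀ b ∈ A, ∀ x y, F b x - F b y ≤ (M + 2 * C) * ‖x - y‖ := by
    intro b hb x y
    have h₁ := (le_abs_self _).trans (hGle b hb (x - y))
    have h₂ := (le_abs_self _).trans (hθlip ‖x - b‖ ‖y - b‖)
    have h₃ := mul_le_mul_of_nonneg_left (hnorm x y b) hC
    have h₄ : G b (x - b) - G b (y - b) = G b (x - y) := by rw [← map_sub]; congr 1; abel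
    simp only [F]
    linarith
  have hself : ∀ x, F x x = 0 := fun x => by simp [F, hθ0]
  have hzero : ∀ x ∈ A, F (a x) x = 0 := by
    intro x hx
    refine le_antisymm ((hmin x x hx).trans_eq (hself x)) ?_
    have h₁ := abs_le.1 (hθA x hx (a x) (ha x))
    have h₂ := hθnn x (a x)
    simp only [F]
    linarith
  have hcont : Continuous fun x => F (a x) x := by
    refine (LipschitzWith.of_dist_le_mul (K := ⟨M + 2 * C, by positivity⟩)
      fun x y => ?_).continuous
    rw [Real.dist_eq, dist_eq_norm]
    change |F (a x) x - F (a y) y| ≤ (M + 2 * C) * ‖x - y‖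
    refine abs_sub_le_iff.2 ⟨?_, ?_⟩
    · linarith [hmin x (a y) (ha y), hFlip (a y) (ha y) x y]
    · rw [norm_sub_rev]
      linarith [hmin y (a x) (ha x), hFlip (a x) (ha x) y x]
  refine ⟨fun x => F (a x) x, hcont, hzero, fun z hz => ?_⟩
  refine HasStrictFDerivAt.of_isLittleO (Asymptotics.isLittleO_iff.2 fun ε hε => ?_)
  obtain ⟨r₁, hr₁, hr₁'⟩ := Metric.continuous_iff.1 hG z (ε / 3) (by positivity)
  obtain ⟨r₂, hr₂, hr₂'⟩ := hθlim (ε / 3) (by positivity)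
  set r := min r₁ (r₂ / 2)
  have hrpos : 0 < r := lt_min hr₁ (half_pos hr₂)
  have hnear : ∀ᶠ x in 𝓝 z, ‖x - z‖ < r ∧ 2 * (M + 2 * C) * ‖x - z‖ < θ r := by
    have h₁ : Continuous fun x => ‖x - z‖ := by fun_prop
    have h₂ : Continuous fun x => 2 * (M + 2 * C) * ‖x - z‖ := by fun_prop
    refine (h₁.tendsto z |>.eventually_lt_const (by simpa)).and
      (h₂.tendsto z |>.eventually_lt_const (by simpa using hθpos r hrpos))
  -- A minimiser at distance at least `r` from `z` would have `F (a x) z ≥ θ r`. Comparing with the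
  -- competitor `z` and using the Lipschitz bound twice gives `F (a x) z ≤ 2 * (M + 2 * C) * ‖x -
  -- z‖`.
  have hclose : ∀ x, ‖x - z‖ < r ∧ 2 * (M + 2 * C) * ‖x - z‖ < θ r → ‖z - a x‖ < r := by
    rintro x ⟨-, hx⟩
    by_contra! hcon
    have h₁ := hθm hcon
    have h₂ := hmin x z hz
    have h₃ := hFlip z hz x z
    have h₄ := hFlip (a x) (ha x) z x
    rw [norm_sub_rev z x] at h₄
    rw [hself] at h₃
    have h₅ := abs_le.1 (hθA z hz (a x) (ha x))
    have h₆ : F (a x) z = G (a x) (z - a x) + 2 * θ ‖z - a x‖ := rfl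
    linarith
  have hdiff : ∀ x y, (‖x - z‖ < r ∧ 2 * (M + 2 * C) * ‖x - z‖ < θ r) →
      (‖y - z‖ < r ∧ 2 * (M + 2 * C) * ‖y - z‖ < θ r) →
      F (a x) x - F (a y) y - G z (x - y) ≤ ε * ‖x - y‖ := by
    intro x y hx hy
    have hay := hclose y hy
    -- Testing the minimum at `x` with the minimiser for `y` reduces the estimate to the increment
    -- of the single function `F (a y)`: the covector costs `ε / 3`, the doubled penalty `2 * ε /
    -- 3`.
    have h₀ := hmin x (a y) (ha y)
    have h₁ : ‖G (a y) - G z‖ < ε / 3 := by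
      rw [← dist_eq_norm]
      refine hr₁' _ ?_
      rw [dist_comm, dist_eq_norm]
      exact hay.trans_le (min_le_left _ _)
    have h₂ : (G (a y) - G z) (x - y) ≤ ε / 3 * ‖x - y‖ :=
      (le_abs_self _).trans (((G (a y) - G z).le_opNorm _).trans
        (mul_le_mul_of_nonneg_right h₁.le (norm_nonneg _)))
    have h₃ : G (a y) (x - a y) - G (a y) (y - a y) = G z (x - y) + (G (a y) - G z) (x - y) := by
      simp only [sub_apply, map_sub]
      ring
    have hb : ∀ w, ‖w - z‖ < r → ‖w - a y‖ ≤ r₂ := by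
      intro w hw
      have : r ≤ r₂ / 2 := min_le_right _ _
      linarith [norm_sub_le_norm_sub_add_norm_sub w z (a y)]
    have h₄ := (le_abs_self _).trans (hr₂' ‖x - a y‖ ‖y - a y‖ (hb x hx.1) (hb y hy.1))
    have h₅ := mul_le_mul_of_nonneg_left (hnorm x y (a y)) (show 0 ≤ ε / 3 by positivity)
    simp only [F] at h₀ ⊢
    linarith
  have hnear' : ∀ᶠ q : V × V in 𝓝 (z, z),
      (‖q.1 - z‖ < r ∧ 2 * (M + 2 * C) * ‖q.1 - z‖ < θ r) ∧
      (‖q.2 - z‖ < r ∧ 2 * (M + 2 * C) * ‖q.2 - z‖ < θ r) := by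
    rw [nhds_prod_eq]
    exact hnear.prod_mk hnear
  filter_upwards [hnear'] with q ⟨hx, hy⟩
  rw [Real.norm_eq_abs, abs_le']
  refine ⟨hdiff _ _ hx hy, ?_⟩
  have h := hdiff _ _ hy hx
  rw [← neg_sub q.1 q.2, map_neg, norm_neg] at h
  linarith

end Whitney

/-! ### Smoothing at a variable scale -/

section Smoothing

open MeasureTheory
open scoped Convolution

variable {V : Type*} [NormedAddCommGroup V] [NormedSpace ℝ V]

/-- Strict differentiability at `z` makes `f - f' z` Lipschitz with small constant near `z`, which
bounds its derivative `f' y - f' z` at nearby points. -/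
theorem continuous_of_forall_hasStrictFDerivAt {f : V → ℝ} {f' : V → V →L[ℝ] ℝ}
    (h : ∀ x, HasStrictFDerivAt f (f' x) x) : Continuous f' := by
  refine Metric.continuous_iff'.2 fun z ε hε => ?_
  obtain ⟨s, hs, hfs⟩ := (h z).approximates_deriv_on_nhds
    (c := ⟨ε / 2, (half_pos hε).le⟩) (Or.inr (half_pos hε))
  filter_upwards [eventually_mem_nhds_iff.2 hs] with y hy
  have hlip := ((h y).hasFDerivAt.sub (f' z).hasFDerivAt).le_of_lipschitzOn hy
    (lipschitzOnWith_iff_restrict.2 hfs.lipschitz_sub)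
  rw [dist_eq_norm]
  exact hlip.trans_lt (half_lt_self hε)

theorem contDiff_one_of_forall_hasStrictFDerivAt {f : V → ℝ} {f' : V → V →L[ℝ] ℝ}
    (h : ∀ x, HasStrictFDerivAt f (f' x) x) : ContDiff ℝ 1 f := by
  refine contDiff_one_iff_fderiv.2 ⟨fun x => (h x).hasFDerivAt.differentiableAt, ?_⟩
  have : fderiv ℝ f = f' := funext fun x => (h x).hasFDerivAt.fderiv
  rw [this]
  exact continuous_of_forall_hasStrictFDerivAt h

variable [MeasurableSpace V] [BorelSpace V] (μ : Measure V)

/-- Averages of a continuous function at a scale which vanishes to first order at a point inherit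
the strict derivative at that point. -/
theorem HasStrictFDerivAt.average_of_scale {f ρ ψ : V → ℝ} {z : V} {f' : V →L[ℝ] ℝ}
    [IsFiniteMeasureOnCompacts μ]
    (hf : Continuous f) (hf' : HasStrictFDerivAt f f' z) (hψ : Continuous ψ)
    (hψ0 : ∀ u, 0 ≤ ψ u) (hψs : ∀ u, ψ u ≠ 0 → ‖u‖ ≤ 1) (hψc : HasCompactSupport ψ)
    (hψi : ∫ u, ψ u ∂μ = 1) (hρ : HasStrictFDerivAt ρ (0 : V →L[ℝ] ℝ) z) (hρz : ρ z = 0) :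
    HasStrictFDerivAt (fun x => ∫ u, ψ u * f (x - ρ x • u) ∂μ) f' z := by
  have hint : ∀ x, Integrable (fun u => ψ u * f (x - ρ x • u)) μ := fun x =>
    Continuous.integrable_of_hasCompactSupport (by fun_prop) hψc.mul_right
  have hψint : Integrable ψ μ := hψ.integrable_of_hasCompactSupport hψc
  refine HasStrictFDerivAt.of_isLittleO (Asymptotics.isLittleO_iff.2 fun ε hε => ?_)
  -- Since `η ≤ 1`, shifted points differ by at most `2 * ‖x - y‖`, so the remainder of `f` costs `ε
  -- / 2`; the second bound makes the shift itself cost another `ε / 2` through `f'`.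
  set η : ℝ := min 1 (ε / (2 * (‖f'‖ + 1)))
  have hηpos : 0 < η := lt_min one_pos (by positivity)
  have hη' : η * ‖f'‖ ≤ ε / 2 := by
    have h₁ : η ≤ ε / (2 * (‖f'‖ + 1)) := min_le_right _ _
    rw [le_div_iff₀ (by positivity)] at h₁
    nlinarith [norm_nonneg f']
  have h₁ := Asymptotics.isLittleO_iff.1 hf'.isLittleO (show 0 < ε / 4 by positivity)
  obtain ⟨δ, hδ, h₁⟩ := Metric.eventually_nhds_iff.1 h₁
  have h₂ := Asymptotics.isLittleO_iff.1 hρ.isLittleO hηpos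
  have hρc : ContinuousAt (fun x => ‖x - z‖ + |ρ x|) z := by
    have := hρ.continuousAt
    fun_prop
  have h₃ : ∀ᶠ x in 𝓝 z, ‖x - z‖ + |ρ x| < δ :=
    hρc.eventually_lt_const (by simpa [hρz] using hδ)
  have h₄ : ∀ᶠ q : V × V in 𝓝 (z, z), ‖q.1 - z‖ + |ρ q.1| < δ ∧ ‖q.2 - z‖ + |ρ q.2| < δ := by
    rw [nhds_prod_eq]
    exact h₃.prod_mk h₃
  have hshift : ∀ x u, ‖u‖ ≤ 1 → ‖x - z‖ + |ρ x| < δ → dist (x - ρ x • u) z < δ := by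
    intro x u hu hx
    rw [dist_eq_norm, sub_right_comm]
    refine (norm_sub_le _ _).trans_lt (lt_of_le_of_lt ?_ hx)
    rw [norm_smul, Real.norm_eq_abs]
    linarith [mul_le_of_le_one_right (abs_nonneg (ρ x)) hu]
  filter_upwards [h₂, h₄] with q hq hq'
  obtain ⟨x, y⟩ := q
  simp only [zero_apply, sub_zero, Real.norm_eq_abs] at hq hq' ⊢
  have hpt : ∀ u, ψ u ≠ 0 →
      |f (x - ρ x • u) - f (y - ρ y • u) - f' (x - y)| ≤ ε * ‖x - y‖ := by
    intro u hu
    have hu1 := hψs u hu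
    have e₁ := h₁ (y := (x - ρ x • u, y - ρ y • u))
      (max_lt (hshift x u hu1 hq'.1) (hshift y u hu1 hq'.2))
    have e₂ : x - ρ x • u - (y - ρ y • u) = (x - y) - (ρ x - ρ y) • u := by
      rw [sub_smul]; abel
    have e₃ : ‖(ρ x - ρ y) • u‖ ≤ η * ‖x - y‖ := by
      rw [norm_smul, Real.norm_eq_abs]
      exact (mul_le_of_le_one_right (abs_nonneg _) hu1).trans hq
    have e₄ : ‖(x - y) - (ρ x - ρ y) • u‖ ≤ 2 * ‖x - y‖ := by
      have : η ≤ 1 := min_le_left _ _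
      nlinarith [norm_sub_le (x - y) ((ρ x - ρ y) • u), norm_nonneg (x - y)]
    have e₅ : |f' ((ρ x - ρ y) • u)| ≤ ε / 2 * ‖x - y‖ := by
      refine (f'.le_opNorm _).trans ?_
      nlinarith [norm_nonneg (x - y), norm_nonneg f']
    simp only [e₂, map_sub, Real.norm_eq_abs] at e₁
    have e₆ : f (x - ρ x • u) - f (y - ρ y • u) - f' (x - y) =
        (f (x - ρ x • u) - f (y - ρ y • u) - (f' x - f' y - f' ((ρ x - ρ y) • u))) -
          f' ((ρ x - ρ y) • u) := by
      rw [map_sub]; ring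
    rw [e₆]
    refine (abs_sub _ _).trans ?_
    nlinarith
  have hdiff : (∫ u, ψ u * f (x - ρ x • u) ∂μ) - (∫ u, ψ u * f (y - ρ y • u) ∂μ) - f' (x - y) =
      ∫ u, ψ u * (f (x - ρ x • u) - f (y - ρ y • u) - f' (x - y)) ∂μ := by
    have e₁ := integral_sub (hint x) (hint y)
    have e₂ := integral_sub ((hint x).sub (hint y)) (hψint.mul_const (f' (x - y)))
    simp only [Pi.sub_apply] at e₂
    rw [e₁, integral_mul_const, hψi, one_mul] at e₂
    rw [← e₂]
    refine integral_congr_ae (Eventually.of_forall fun u => ?_)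
    ring
  rw [hdiff, ← Real.norm_eq_abs]
  have hle := norm_integral_le_of_norm_le (hψint.mul_const (ε * ‖x - y‖))
    (f := fun u => ψ u * (f (x - ρ x • u) - f (y - ρ y • u) - f' (x - y)))
    (Eventually.of_forall fun u => ?_)
  · rwa [integral_mul_const, hψi, one_mul] at hle
  · rw [norm_mul, Real.norm_of_nonneg (hψ0 u)]
    by_cases hu : ψ u = 0
    · simp [hu]
    · exact mul_le_mul_of_nonneg_left (hpt u hu) (hψ0 u)

/-- Where `ρ > 0`, a change of variables writes the average as a normalised convolution of `f` with
`ψ` rescaled by `ρ x`, so all dependence on `x` falls on `C^1` data rather than on `f`. The bound `ρ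
≤ 1` keeps the kernels supported in one compact ball. -/
theorem contDiffOn_average_of_scale [FiniteDimensional ℝ V] [μ.IsAddHaarMeasure] {f ρ ψ : V → ℝ}
    {U : Set V} (hU : IsOpen U) (hf : Continuous f) (hψ : ContDiff ℝ 1 ψ)
    (hψs : ∀ u, ψ u ≠ 0 → ‖u‖ ≤ 1) (hρ : ContDiff ℝ 1 ρ)
    (hρU : ∀ x ∈ U, 0 < ρ x) (hρ1 : ∀ x, ρ x ≤ 1) :
    ContDiffOn ℝ 1 (fun x => ∫ u, ψ u * f (x - ρ x • u) ∂μ) U := by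
  have hconv : ContDiffOn ℝ 1
      (fun x => (f ⋆[ContinuousLinearMap.mul ℝ ℝ, μ] fun u => ψ ((ρ x)⁻¹ • u)) x) U := by
    refine contDiffOn_convolution_right_with_param_comp (n := 1) (ContinuousLinearMap.mul ℝ ℝ)
      (g := fun x u => ψ ((ρ x)⁻¹ • u)) contDiffOn_id hU
      (isCompact_closedBall (0 : V) 1) ?_ hf.locallyIntegrable ?_
    · intro x u hx hu
      by_contra hne
      have h₁ := hψs _ hne
      rw [norm_smul, norm_inv, Real.norm_of_nonneg (hρU x hx).le,
        inv_mul_le_iff₀ (hρU x hx), mul_one] at h₁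
      exact hu (mem_closedBall_zero_iff.2 (h₁.trans (hρ1 x)))
    · have h₁ : ContDiffOn ℝ 1 (fun q : V × V => (ρ q.1)⁻¹ • q.2) (U ×ˢ Set.univ) := by
        refine ContDiffOn.smul (ContDiffOn.inv ?_ ?_) contDiff_snd.contDiffOn
        · exact (hρ.comp contDiff_fst).contDiffOn
        · exact fun q hq => (hρU q.1 hq.1).ne'
      exact hψ.comp_contDiffOn h₁
  have hpow : ContDiffOn ℝ 1 (fun x => (ρ x ^ Module.finrank ℝ V)⁻¹) U :=
    (hρ.pow _).contDiffOn.inv fun x hx => (pow_pos (hρU x hx) _).ne'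
  refine (hpow.mul hconv).congr fun x hx => ?_
  have hp := hρU x hx
  have h₁ := integral_sub_left_eq_self (fun t => f t * ψ ((ρ x)⁻¹ • (x - t))) μ x
  have h₂ := Measure.integral_comp_inv_smul μ (fun u => ψ u * f (x - ρ x • u)) (ρ x)
  simp only [sub_sub_cancel, smul_inv_smul₀ hp.ne', smul_eq_mul, abs_of_pos (pow_pos hp _)] at h₁ h₂
  rw [convolution_def]
  simp only [ContinuousLinearMap.mul_apply']
  rw [← h₁]
  simp only [mul_comm (f _)]
  rw [h₂, inv_mul_cancel_left₀ (pow_pos hp _).ne']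

end Smoothing

/-! ### The `C^1` Whitney extension with zero values -/

section

variable {V : Type*} [NormedAddCommGroup V] [NormedSpace ℝ V] [FiniteDimensional ℝ V]

/-- A continuous function which is strictly differentiable at the points of a closed set can be
replaced by a `C^1` function with the same values and derivatives on this set. -/
theorem exists_contDiff_of_hasStrictFDerivAt {A : Set V} (hA : IsClosed A) {f : V → ℝ}
    {G : V → V →L[ℝ] ℝ} (hf : Continuous f) (hG : ∀ z ∈ A, HasStrictFDerivAt f (G z) z) :
    ∃ g : V → ℝ, ContDiff ℝ 1 g ∧ ∀ z ∈ A, g z = f z ∧ HasFDerivAt g (G z) z := by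
  borelize V
  let μ : MeasureTheory.Measure V := MeasureTheory.Measure.addHaar
  let φ : ContDiffBump (0 : V) := ⟨1 / 2, 1, by norm_num, by norm_num⟩
  -- The scale `ρ` vanishes exactly on `A`. Being nonnegative, it has a minimum and hence zero
  -- derivative there, so averaging preserves values and strict derivatives on `A`.
  obtain ⟨ρ, hρs, hρ, hρr⟩ := hA.isOpen_compl.exists_contDiff_support_eq (n := 1)
  have hρ0 : ∀ x, 0 ≤ ρ x := fun x => (hρr ⟨x, rfl⟩).1
  have hρA : ∀ z ∈ A, ρ z = 0 := by
    intro z hz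
    by_contra h
    have : z ∈ Function.support ρ := h
    rw [hρs] at this
    exact this hz
  have hρU : ∀ x ∈ Aᶜ, 0 < ρ x := by
    intro x hx
    rw [← hρs] at hx
    exact (hρ0 x).lt_of_ne' hx
  have hψs : ∀ u, φ.normed μ u ≠ 0 → ‖u‖ ≤ 1 := by
    intro u hu
    have : u ∈ Function.support (φ.normed μ) := hu
    rw [φ.support_normed_eq, mem_ball_zero_iff] at this
    exact this.le
  have hψi : ∫ u, φ.normed μ u ∂μ = 1 := φ.integral_normed
  let g : V → ℝ := fun x => ∫ u, φ.normed μ u * f (x - ρ x • u) ∂μ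
  have hstrict : ∀ z ∈ A, HasStrictFDerivAt g (G z) z := by
    intro z hz
    have hρz : HasStrictFDerivAt ρ (0 : V →L[ℝ] ℝ) z := by
      have h := hρ.contDiffAt.hasStrictFDerivAt (x := z) (by norm_num)
      have hmin : IsLocalMin ρ z := Eventually.of_forall fun x => by rw [hρA z hz]; exact hρ0 x
      rwa [hmin.fderiv_eq_zero] at h
    exact (hG z hz).average_of_scale μ hf φ.continuous_normed φ.nonneg_normed hψs
      φ.hasCompactSupport_normed hψi hρz (hρA z hz)
  have hoff : ContDiffOn ℝ 1 g Aᶜ := contDiffOn_average_of_scale μ hA.isOpen_compl hf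
    φ.contDiff_normed hψs hρ hρU fun x => (hρr ⟨x, rfl⟩).2
  have hall : ∀ x, HasStrictFDerivAt g (fderiv ℝ g x) x := by
    intro x
    by_cases hx : x ∈ A
    · have h := hstrict x hx
      rwa [h.hasFDerivAt.fderiv]
    · exact (hoff.contDiffAt (hA.isOpen_compl.mem_nhds hx)).hasStrictFDerivAt (by norm_num)
  refine ⟨g, contDiff_one_of_forall_hasStrictFDerivAt hall, fun z hz =>
    ⟨?_, (hstrict z hz).hasFDerivAt⟩⟩
  simp only [g, hρA z hz, zero_smul, sub_zero, MeasureTheory.integral_mul_const, hψi, one_mul]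

/-- The `C^1` Whitney extension theorem for jets with vanishing values: a continuous field of
covectors which annihilates the secants of `A` in the limit agrees at any given point of `A` with
the derivative of a `C^1` function vanishing on `A`. -/
theorem exists_contDiff_of_secant {A : Set V} (hA : IsClosed A) {G : V → V →L[ℝ] ℝ}
    (hG : Continuous G)
    (hsec : ∀ z ∈ A, ∀ ε > 0, ∀ᶠ q : V × V in 𝓝 (z, z), q.1 ∈ A → q.2 ∈ A →
      |G z (q.1 - q.2)| ≤ ε * ‖q.1 - q.2‖) {z : V} (hz : z ∈ A) :
    ∃ f : V → ℝ, ContDiff ℝ 1 f ∧ (∀ x ∈ A, f x = 0) ∧ HasFDerivAt f (G z) z := by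
  -- The envelope construction needs compactness; a cutoff supported in the unit ball and equal to
  -- one near `z` then restores vanishing on the rest of `A`.
  set B := A ∩ closedBall z 1
  have hB : IsCompact B := (isCompact_closedBall z 1).inter_left hA
  have hzB : z ∈ B := ⟨hz, mem_closedBall_self zero_le_one⟩
  obtain ⟨f, hf, hf0, hf'⟩ := exists_lipschitz_extension hB ⟨z, hzB⟩ hG (fun x hx ε hε => by
    filter_upwards [hsec x hx.1 ε hε] with q hq h₁ h₂ using hq h₁.1 h₂.1)
  obtain ⟨g, hg, hgB⟩ := exists_contDiff_of_hasStrictFDerivAt hB.isClosed hf hf'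
  let φ : ContDiffBump z := ⟨1 / 2, 1, by norm_num, by norm_num⟩
  refine ⟨fun x => φ x * g x, φ.contDiff.mul hg, fun x hx => ?_, ?_⟩
  · dsimp only
    by_cases hxz : x ∈ closedBall z 1
    · rw [(hgB x ⟨hx, hxz⟩).1, hf0 x ⟨hx, hxz⟩, mul_zero]
    · rw [φ.zero_of_le_dist (not_le.1 hxz).le, zero_mul]
  · refine (hgB z hzB).2.congr_of_eventuallyEq ?_
    filter_upwards [φ.eventuallyEq_one] with x hx
    rw [hx, Pi.one_apply, one_mul]

end

/-! ### Conormal spaces and Zariski tangent vectors -/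

section Conormal

variable {n : ℕ}

/-- The linear functional on `ℝ^n` with the given coefficients. -/
def covector (p : Fin n → ℝ) : (Fin n → ℝ) →L[ℝ] ℝ :=
  ∑ i, p i • ContinuousLinearMap.proj i

theorem covector_apply (p v : Fin n → ℝ) : covector p v = ∑ i, p i * v i := by
  simp [covector, sum_apply]

theorem covector_coeff (L : (Fin n → ℝ) →L[ℝ] ℝ) : covector (fun i => L (Pi.single i 1)) = L := by
  refine ContinuousLinearMap.ext fun v => ?_
  rw [covector_apply]
  have h := LinearMap.pi_apply_eq_sum_univ L.toLinearMap v
  simp only [ContinuousLinearMap.coe_coe, smul_eq_mul] at h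
  rw [h]
  refine Finset.sum_congr rfl fun i _ => ?_
  rw [mul_comm]
  congr 2
  ext j
  simp [Pi.single_apply, eq_comm]

theorem continuous_covector : Continuous (covector (n := n)) := by
  unfold covector
  fun_prop

/-- The covectors at `z` which annihilate the secants of `A` in the limit. -/
def secantAnnihilator (A : Set (Fin n → ℝ)) (z : Fin n → ℝ) : Submodule ℝ (Fin n → ℝ) where
  carrier := {p | ∀ ε > 0, ∀ᶠ q : (Fin n → ℝ) × (Fin n → ℝ) in 𝓝 (z, z), q.1 ∈ A → q.2 ∈ A →
    |covector p (q.1 - q.2)| ≤ ε * ‖q.1 - q.2‖}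
  zero_mem' := fun ε hε => Eventually.of_forall fun q _ _ => by
    have : covector (0 : Fin n → ℝ) (q.1 - q.2) = 0 := by simp [covector_apply]
    rw [this, abs_zero]
    positivity
  add_mem' := by
    intro p p' hp hp' ε hε
    filter_upwards [hp _ (half_pos hε), hp' _ (half_pos hε)] with q h h' h₁ h₂
    have : covector (p + p') (q.1 - q.2) = covector p (q.1 - q.2) + covector p' (q.1 - q.2) := by
      simp only [covector_apply, Pi.add_apply, add_mul, Finset.sum_add_distrib]
    rw [this]
    linarith [abs_add_le (covector p (q.1 - q.2)) (covector p' (q.1 - q.2)), h h₁ h₂, h' h₁ h₂]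
  smul_mem' := by
    intro c p hp ε hε
    have hc : 0 < |c| + 1 := by positivity
    filter_upwards [hp (ε / (|c| + 1)) (by positivity)] with q h h₁ h₂
    have e : covector (c • p) (q.1 - q.2) = c * covector p (q.1 - q.2) := by
      simp only [covector_apply, Pi.smul_apply, smul_eq_mul, mul_assoc, Finset.mul_sum]
    have h := h h₁ h₂
    rw [div_mul_eq_mul_div, le_div_iff₀ hc] at h
    rw [e, abs_mul]
    nlinarith [abs_nonneg (covector p (q.1 - q.2))]

theorem mem_secantAnnihilator {A : Set (Fin n → ℝ)} {z p : Fin n → ℝ} :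
    p ∈ secantAnnihilator A z ↔ ∀ ε > 0, ∀ᶠ q : (Fin n → ℝ) × (Fin n → ℝ) in 𝓝 (z, z),
      q.1 ∈ A → q.2 ∈ A → |covector p (q.1 - q.2)| ≤ ε * ‖q.1 - q.2‖ :=
  Iff.rfl

/-- The `C^1`-Zariski conormal spaces of a closed set, obtained by Glaeser refinement. -/
noncomputable def conormalSpace (A : Set (Fin n → ℝ)) : (Fin n → ℝ) → Submodule ℝ (Fin n → ℝ) :=
  glaeserRefinement^[2 * (Module.finrank ℝ (Fin n → ℝ) + 1)] (secantAnnihilator A)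

theorem mem_iterate_glaeserRefinement {X W : Type*} [TopologicalSpace X] [NormedAddCommGroup W]
    [NormedSpace ℝ W] {B : X → Submodule ℝ W} {p : X → W} (hp : Continuous p)
    (hs : ∀ x, p x ∈ B x) (k : ℕ) (x : X) : p x ∈ glaeserRefinement^[k] B x := by
  induction k generalizing x with
  | zero => exact hs x
  | succ k ih =>
    rw [Function.iterate_succ_apply']
    refine ⟨ih x, fun ε hε => ?_⟩
    filter_upwards [Metric.continuous_iff'.1 hp x ε hε] with y hy
    exact ⟨p y, ih y, by rwa [← dist_eq_norm, dist_comm]⟩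

/-- Forward, stability under refinement gives a continuous section through `p`, which Whitney
extension realises as a differential. Backward, the differential of `f` is a continuous section of
the secant annihilators, and continuous sections survive every refinement. -/
theorem mem_conormalSpace_iff {A : Set (Fin n → ℝ)} (hA : IsClosed A) {z : Fin n → ℝ} (hz : z ∈ A)
    {p : Fin n → ℝ} : p ∈ conormalSpace A z ↔ ∃ f : (Fin n → ℝ) → ℝ, ContDiff ℝ 1 f ∧
      (∀ y ∈ A, f y = 0) ∧ fderiv ℝ f z = covector p := by
  constructor
  · intro hp
    obtain ⟨g, hg, hgz⟩ := exists_continuous_section (B := conormalSpace A)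
      (fun x => Submodule.closed_of_finiteDimensional _) (fun x q hq => by
        rw [conormalSpace, ← glaeserRefinement_iterate_fixed] at hq
        exact hq.2) hp
    have hle : ∀ k x, glaeserRefinement^[k] (secantAnnihilator A) x ≤ secantAnnihilator A x := by
      intro k x
      induction k with
      | zero => exact le_rfl
      | succ k ih =>
        rw [Function.iterate_succ_apply']
        exact (glaeserRefinement_le _ _).trans ih
    obtain ⟨f, hf, hfA, hfz⟩ := exists_contDiff_of_secant hA
      (continuous_covector.comp g.continuous) (fun x _ => hle _ x (hg x)) hz
    exact ⟨f, hf, hfA, by rw [hfz.fderiv, Function.comp_apply, hgz]⟩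
  · rintro ⟨f, hf, hfA, hfz⟩
    let q : (Fin n → ℝ) → Fin n → ℝ := fun y i => fderiv ℝ f y (Pi.single i 1)
    have hq : Continuous q := continuous_pi fun i =>
      (hf.continuous_fderiv (by norm_num)).clm_apply continuous_const
    have hqz : q z = p := by
      ext i
      simp only [q]
      rw [hfz, covector_apply]
      simp [Pi.single_apply]
    rw [← hqz]
    refine mem_iterate_glaeserRefinement (B := secantAnnihilator A) hq (fun y ε hε => ?_) _ z
    have h := (hf.contDiffAt (x := y)).hasStrictFDerivAt (by norm_num)
    filter_upwards [Asymptotics.isLittleO_iff.1 h.isLittleO hε] with w hw h₁ h₂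
    rwa [hfA _ h₁, hfA _ h₂, sub_zero, zero_sub, norm_neg, Real.norm_eq_abs,
      ← covector_coeff (fderiv ℝ f y)] at hw

theorem mem_zariskiTangent_iff {A : Set (Fin n → ℝ)} (hA : IsClosed A) {z : Fin n → ℝ}
    (hz : z ∈ A) {v : Fin n → ℝ} :
    v ∈ zariskiTangent A z ↔ ∀ p ∈ conormalSpace A z, ∑ i, p i * v i = 0 := by
  constructor
  · intro hv p hp
    obtain ⟨f, hf, hfA, hfz⟩ := (mem_conormalSpace_iff hA hz).1 hp
    rw [← covector_apply, ← hfz]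
    exact hv f hf hfA
  · intro h f hf hfA
    have := h _ ((mem_conormalSpace_iff hA hz).2 ⟨f, hf, hfA, (covector_coeff _).symm⟩)
    rwa [← covector_apply, covector_coeff] at this

theorem zariskiTangent_closure (A : Set (Fin n → ℝ)) :
    zariskiTangent (closure A) = zariskiTangent A := by
  ext z v
  refine forall₂_congr fun f hf => imp_congr_left ⟨fun h y hy => h y (subset_closure hy), ?_⟩
  intro h y hy
  exact closure_minimal (t := {y | f y = 0}) h (isClosed_eq hf.continuous continuous_const) hy

/-- The norm is not polynomial, so `‖x - y‖` is replaced by an auxiliary variable `r` ranging over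
all larger reals, and the absolute value by two inequalities; every atom then fits the definability
calculus. -/
theorem mem_secantAnnihilator_iff_forall_lt {A : Set (Fin n → ℝ)} {z p : Fin n → ℝ} :
    p ∈ secantAnnihilator A z ↔ ∀ ε : ℝ, 0 < ε → ∃ δ : ℝ, 0 < δ ∧ ∀ x y : Fin n → ℝ,
      ‖x - z‖ < δ → ‖y - z‖ < δ → x ∈ A → y ∈ A → ∀ r : ℝ, ‖x - y‖ < r →
        ∑ i, p i * (x i - y i) ≤ ε * r ∧ 0 - ε * r ≤ ∑ i, p i * (x i - y i) := by
  rw [mem_secantAnnihilator]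
  refine forall₂_congr fun ε hε => ?_
  rw [Metric.eventually_nhds_iff]
  refine exists_congr fun δ => and_congr_right fun _ => ?_
  simp only [Prod.forall, Prod.dist_eq, max_lt_iff, and_imp]
  simp only [dist_eq_norm, covector_apply, Pi.sub_apply]
  refine forall₂_congr fun x y => forall₄_congr fun _ _ _ _ => ?_
  rw [abs_le]
  constructor
  · rintro ⟨h₁, h₂⟩ r hr
    have := mul_le_mul_of_nonneg_left hr.le hε.le
    constructor <;> linarith
  · intro h
    have h' : ∀ r > ‖x - y‖, |∑ i, p i * (x i - y i)| / ε ≤ r := by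
      intro r hr
      rw [div_le_iff₀ hε, abs_le]
      have := h r hr
      constructor <;> linarith
    have := le_of_forall_gt_imp_ge_of_dense h'
    rw [div_le_iff₀ hε, abs_le] at this
    constructor <;> linarith

theorem mem_glaeserRefinement_iff_exists {B : (Fin n → ℝ) → Submodule ℝ (Fin n → ℝ)}
    {z p : Fin n → ℝ} : p ∈ glaeserRefinement B z ↔ p ∈ B z ∧ ∀ ε : ℝ, 0 < ε → ∃ δ : ℝ, 0 < δ ∧
      ∀ y, ‖y - z‖ < δ → ∃ q, q ∈ B y ∧ ‖p - q‖ < ε := by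
  simp only [mem_glaeserRefinement, Metric.eventually_nhds_iff, dist_eq_norm, gt_iff_lt]

end Conormal

/-! ### Definability of the conormal and tangent bundles -/

namespace RealFieldExpansion

variable {S : RealFieldExpansion} {n : ℕ}

theorem defPred_secantAnnihilator {A : Set (Fin n → ℝ)} (hA : S.DefPred (fun x => x ∈ A)) :
    S.DefPred (fun q : (Fin n → ℝ) × (Fin n → ℝ) => q.2 ∈ secantAnnihilator A q.1) := by
  simp only [mem_secantAnnihilator_iff_forall_lt]
  refine .all (.imp (.lt (.const 0) (.of_isLinearMap ⟨fun _ _ => rfl, fun _ _ => rfl⟩)) (.ex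
    (.and (.lt (.const 0) (.of_isLinearMap ⟨fun _ _ => rfl, fun _ _ => rfl⟩)) (.all (.all
    (.imp (.norm_sub_lt ⟨fun _ _ => rfl, fun _ _ => rfl⟩ ⟨fun _ _ => rfl, fun _ _ => rfl⟩
      (.of_isLinearMap ⟨fun _ _ => rfl, fun _ _ => rfl⟩))
    (.imp (.norm_sub_lt ⟨fun _ _ => rfl, fun _ _ => rfl⟩ ⟨fun _ _ => rfl, fun _ _ => rfl⟩
      (.of_isLinearMap ⟨fun _ _ => rfl, fun _ _ => rfl⟩))
    (.imp (hA.comp _ ⟨fun _ _ => rfl, fun _ _ => rfl⟩)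
    (.imp (hA.comp _ ⟨fun _ _ => rfl, fun _ _ => rfl⟩) (.all (.imp (.norm_sub_lt
      ⟨fun _ _ => rfl, fun _ _ => rfl⟩ ⟨fun _ _ => rfl, fun _ _ => rfl⟩
      (.of_isLinearMap ⟨fun _ _ => rfl, fun _ _ => rfl⟩)) ?_)))))))))))
  refine .and (.le (.sum _ fun i => .mul ?_ (.sub ?_ ?_)) (.mul ?_ ?_))
    (.le (.sub (.const 0) (.mul ?_ ?_)) (.sum _ fun i => .mul ?_ (.sub ?_ ?_))) <;>
  exact .of_isLinearMap ⟨fun _ _ => rfl, fun _ _ => rfl⟩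

theorem defPred_glaeserRefinement {B : (Fin n → ℝ) → Submodule ℝ (Fin n → ℝ)}
    (hB : S.DefPred (fun q : (Fin n → ℝ) × (Fin n → ℝ) => q.2 ∈ B q.1)) :
    S.DefPred (fun q : (Fin n → ℝ) × (Fin n → ℝ) => q.2 ∈ glaeserRefinement B q.1) := by
  simp only [mem_glaeserRefinement_iff_exists]
  refine .and hB (.all (.imp (.lt (.const 0)
    (.of_isLinearMap ⟨fun _ _ => rfl, fun _ _ => rfl⟩)) (.ex
    (.and (.lt (.const 0) (.of_isLinearMap ⟨fun _ _ => rfl, fun _ _ => rfl⟩)) (.all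
    (.imp (.norm_sub_lt ⟨fun _ _ => rfl, fun _ _ => rfl⟩ ⟨fun _ _ => rfl, fun _ _ => rfl⟩
      (.of_isLinearMap ⟨fun _ _ => rfl, fun _ _ => rfl⟩)) (.ex (.and ?_
    (.norm_sub_lt ⟨fun _ _ => rfl, fun _ _ => rfl⟩ ⟨fun _ _ => rfl, fun _ _ => rfl⟩
      (.of_isLinearMap ⟨fun _ _ => rfl, fun _ _ => rfl⟩))))))))))
  exact hB.comp (fun c : (((((Fin n → ℝ) × (Fin n → ℝ)) × ℝ) × ℝ) × (Fin n → ℝ)) × (Fin n → ℝ) =>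
    (c.1.2, c.2)) ⟨fun _ _ => rfl, fun _ _ => rfl⟩

theorem defPred_closure {A : Set (Fin n → ℝ)} (hA : S.DefPred (fun x => x ∈ A)) :
    S.DefPred (fun x => x ∈ closure A) := by
  simp only [Metric.mem_closure_iff, dist_eq_norm, gt_iff_lt]
  exact .all (.imp (.lt (.const 0) (.of_isLinearMap ⟨fun _ _ => rfl, fun _ _ => rfl⟩)) (.ex
    (.and (hA.comp _ ⟨fun _ _ => rfl, fun _ _ => rfl⟩)
    (.norm_sub_lt ⟨fun _ _ => rfl, fun _ _ => rfl⟩ ⟨fun _ _ => rfl, fun _ _ => rfl⟩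
      (.of_isLinearMap ⟨fun _ _ => rfl, fun _ _ => rfl⟩)))))

/-- Any fixed number of refinements preserves definability. The number used depends only on `n`, so
one formula serves all points. -/
theorem defPred_conormalSpace {A : Set (Fin n → ℝ)} (hA : S.DefPred (fun x => x ∈ A)) :
    S.DefPred (fun q : (Fin n → ℝ) × (Fin n → ℝ) => q.2 ∈ conormalSpace A q.1) := by
  unfold conormalSpace
  generalize 2 * (Module.finrank ℝ (Fin n → ℝ) + 1) = k
  induction k with
  | zero => exact defPred_secantAnnihilator hA
  | succ k ih =>
    simp only [Function.iterate_succ_apply']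
    exact defPred_glaeserRefinement ih

theorem defPred_zariskiTangent {A : Set (Fin n → ℝ)} (hA : S.DefPred (fun x => x ∈ A)) :
    S.DefPred (fun q : (Fin n → ℝ) × (Fin n → ℝ) => q.1 ∈ A ∧ q.2 ∈ zariskiTangent A q.1) := by
  have h : ∀ q : (Fin n → ℝ) × (Fin n → ℝ), (q.1 ∈ A ∧ q.2 ∈ zariskiTangent A q.1) ↔
      (q.1 ∈ A ∧ ∀ p, p ∈ conormalSpace (closure A) q.1 → ∑ i, p i * q.2 i = 0) := by
    intro q
    refine and_congr_right fun hq => ?_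
    rw [← zariskiTangent_closure]
    exact mem_zariskiTangent_iff isClosed_closure (subset_closure hq)
  simp only [h]
  have hcon := (defPred_conormalSpace (defPred_closure hA)).comp
    (fun c : ((Fin n → ℝ) × (Fin n → ℝ)) × (Fin n → ℝ) => (c.1.1, c.2))
    ⟨fun _ _ => rfl, fun _ _ => rfl⟩
  exact .and (hA.comp _ ⟨fun _ _ => rfl, fun _ _ => rfl⟩) (.all (.imp hcon
    (.eq (.sum _ fun i => .mul (.of_isLinearMap ⟨fun _ _ => rfl, fun _ _ => rfl⟩)
      (.of_isLinearMap ⟨fun _ _ => rfl, fun _ _ => rfl⟩)) (.const 0))))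

theorem IsDefinableMap.defPred {m : ℕ} (hn : 1 ≤ n) {f : (Fin n → ℝ) → (Fin m → ℝ)}
    (hf : S.IsDefinableMap f) : S.DefPred (fun q : (Fin n → ℝ) × (Fin m → ℝ) => q.2 = f q.1) := by
  have h := (DefPred.of_mem (by omega) hf).comp
    (fun q : (Fin n → ℝ) × (Fin m → ℝ) => (Fin.append q.1 q.2 : Fin (n + m) → ℝ)) ⟨?_, ?_⟩
  · simpa using h
  · intro q q'
    ext i
    refine Fin.addCases (fun i => ?_) (fun i => ?_) i <;> simp
  · intro c q
    ext i
    refine Fin.addCases (fun i => ?_) (fun i => ?_) i <;> simp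

end RealFieldExpansion

theorem mainTheorem7 (S : RealFieldExpansion) (n : ℕ) (hn : 1 ≤ n) :
    (∀ A : Set (Fin n → ℝ), IsClosed A → S.IsDefinable A →
      S.IsDefinable (zariskiTangentBundle A)) ∧
    (∀ (r : ℕ) (X : Fin r → (Fin n → ℝ) → (Fin n → ℝ)), (∀ j, S.IsDefinableMap (X j)) →
      ∀ A : Set (Fin n → ℝ), S.IsDefinable A → S.IsDefinable (charSet X A)) := by
  constructor
  · intro A _ hA
    have h := (RealFieldExpansion.defPred_zariskiTangent (.of_mem hn hA)).comp
      (fun z : Fin (n + n) → ℝ =>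
        ((fun i => z (Fin.castAdd n i)), (fun i => z (Fin.natAdd n i))))
      ⟨fun _ _ => rfl, fun _ _ => rfl⟩
    exact h.mem (by omega)
  · intro r X hX A hA
    have hA' := RealFieldExpansion.DefPred.of_mem hn hA
    -- Since `X j` is only known through its graph, its value is introduced by a quantifier over
    -- `v`. The repeated `p ∈ A` is needed because tangency is shown definable only together with
    -- membership of the base point.
    have h : S.DefPred (fun p => p ∈ A ∧ ∀ j, ∃ v, v = X j p ∧ p ∈ A ∧ v ∈ zariskiTangent A p) :=
      hA'.and (.forall_fin fun j => .ex
        (.and ((hX j).defPred hn) (RealFieldExpansion.defPred_zariskiTangent hA')))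
    convert h.mem hn using 1
    ext p
    simp only [charSet, exists_eq_left, Set.mem_ofPred_eq]
    exact and_congr_right fun hp => by simp [hp]
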